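/- **Model.** A network is a finite connected simple graph whose nodes are anonymous; every node gives pairwise distinct, otherwise arbitrary, natural-number labels to its incident links and has a whiteboard. There are $k\ge 1$ agents. Each agent has been given a piece of gossip information from a set $I$ with at least two elements (different agents may have equal pieces). The agents are anonymous and identical: all execute the same deterministic state machine, without identifiers and without knowledge of $k$ or of the network; state spaces need not be finite. The memory of an agent and (full whiteboards) that of a node consist of control information and of a finite set of pieces of gossip information. The system is synchronous. In every round all agents execute one action each; agents at the same node act in sequence, in an arbitrary order. An action depends on the agent's own gossip information and current state, the current states of the other agents at its node (as a multiset), the link labels of the node (and, in one variant of the model, the label of the link by which the agent reached the node), the contents of the whiteboard, and on whether the agent migrated at the end of the previous round. It changes the agent's state and the whiteboard and chooses at most one incident link for migration. Gossip information can be kept, dropped, copied and relayed, but not made up: after an action, the agent and the whiteboard hold only pieces that were the agent's own or were held by the agent, by the whiteboard or by an agent at the node when the action was executed. The chosen migrations then take place simultaneously. With full-duplex links all of them succeed; with half-duplex links, if a link is requested in both directions in the same round, only those in one (arbitrary) direction succeed and the other agents stay where they are. A *self-stabilizing solution* of the gossip problem is an algorithm such that on every network, for every number of agents, for all gossip information,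 and in every execution from an arbitrary initial configuration (arbitrary positions, agent states and whiteboard contents), from some round on every agent always knows the gossip information of all agents. An algorithm is *$l$-quiescent* with $k$ agents if every execution with $k$ agents reaches a configuration after which at least $l$ agents remain still forever. The *quiescence number* of the $k$-gossip problem is the maximum $l\ge 0$ for which there is a self-stabilizing solution that is $l$-quiescent with $k$ agents, and $-1$ if there is none. **Theorem.** For every $k\ge 1$, in the synchronous model with full whiteboards and anonymous agents, with half-duplex as well as with full-duplex links (and whether or not agents see the labels of incoming links), the quiescence number of the $k$-gossip problem exists and is at least $0$ and at most $k-1$. -/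

import Mathlib

namespace MobileAgents

/-- A network: a connected simple graph (on a finite node set, wherever it is used) in which every
node gives pairwise distinct, otherwise arbitrary, labels to its incident links. The label that `v`
gives to the link `vw` is `label v w`. Nodes carry no identifiers. -/
structure Network (V : Type) where
  graph : SimpleGraph V
  connected : graph.Connected
  label : V → V → ℕ
  label_injective : ∀ v w w', graph.Adj v w → graph.Adj v w' → label v w = label v w' → w = w'

namespace Network

variable {V : Type}

open scoped Classical in
/-- The set of local link labels of the node `v`. -/
noncomputable def labels [Fintype V] (N : Network V) (v : V) : Finset ℕ :=
  (Finset.univ.filter fun w => N.graph.Adj v w).image (N.label v)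

open scoped Classical in
/-- The node reached from `v` through the link labelled `p` at `v`, if there is such a link. -/
noncomputable def dest (N : Network V) (v : V) (p : ℕ) : Option V :=
  if h : ∃ w, N.graph.Adj v w ∧ N.label v w = p then some h.choose else none

end Network

/-- The variants of the synchronous model: half-duplex or full-duplex links, and whether or not an
agent sees the label of the link through which it reached its current node. -/
structure Variant where
  halfDuplex : Bool
  inLabels : Bool

/-- The contents of a memory (of an agent, or of a full whiteboard): control information, and the
finite set of the pieces of gossip information that are stored there. -/
structure Memory (C I : Type) where
  ctrl : C
  known : Finset I

/-- Everything an action of an agent may depend on. -/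
structure View (C W I : Type) where
  /-- the gossip information that the agent was given -/
  own : I
  /-- the current state of the agent -/
  mem : Memory C I
  /-- whether the agent migrated at the end of the previous round -/
  moved : Bool
  /-- the label of the incoming link (always `none` in the variant in which it is not seen) -/
  inLabel : Option ℕ
  /-- the link labels of the current node -/
  labels : Finset ℕ
  /-- the current states of the other agents at the node -/
  others : Multiset (Memory C I)
  /-- the whiteboard of the node -/
  board : Memory W I

/-- The gossip information that is present in a view. -/
def View.available {C W I : Type} (v : View C W I) : Set I :=
  {x | x = v.own ∨ x ∈ v.mem.known ∨ x ∈ v.board.known ∨ ∃ m ∈ v.others, x ∈ m.known}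

/-- The outcome of an action: the new state of the agent, the new contents of the whiteboard of the
node, and the label of the link along which the agent wants to migrate (if any). -/
structure Action (C W I : Type) where
  mem : Memory C I
  board : Memory W I
  move : Option ℕ

/-- A distributed algorithm for anonymous agents with full whiteboards: one deterministic state
machine, executed by all the agents. Control information is arbitrary. Gossip information can be
kept, dropped, relayed to co-located agents and written on whiteboards, but it cannot be made up:
after an action the agent and the whiteboard only hold pieces that were available to the action. -/
structure Algorithm (I : Type) where
  Ctrl : Type
  BoardCtrl : Type
  ctrl_nonempty : Nonempty Ctrl
  boardCtrl_nonempty : Nonempty BoardCtrl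
  act : View Ctrl BoardCtrl I → Action Ctrl BoardCtrl I
  mem_available : ∀ v, ∀ x ∈ (act v).mem.known, x ∈ v.available
  board_available : ∀ v, ∀ x ∈ (act v).board.known, x ∈ v.available

/-- A configuration of `k` agents on a network with node set `V`. The indices in `Fin k` serve to
describe the system; they are not visible to the agents. -/
structure Config {I : Type} (A : Algorithm I) (V : Type) (k : ℕ) where
  pos : Fin k → V
  mem : Fin k → Memory A.Ctrl I
  moved : Fin k → Bool
  inLabel : Fin k → Option ℕ
  board : V → Memory A.BoardCtrl I

section Round

variable {I : Type} {A : Algorithm I} {V : Type} {k : ℕ}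

open scoped Classical in
/-- What agent `i` perceives in the configuration `c`. -/
noncomputable def view [Fintype V] (M : Variant) (N : Network V) (info : Fin k → I)
    (c : Config A V k) (i : Fin k) : View A.Ctrl A.BoardCtrl I where
  own := info i
  mem := c.mem i
  moved := c.moved i
  inLabel := if M.inLabels then c.inLabel i else none
  labels := N.labels (c.pos i)
  others := (Finset.univ.filter fun j => j ≠ i ∧ c.pos j = c.pos i).val.map c.mem
  board := c.board (c.pos i)

open scoped Classical in
/-- Agent `i` executes its action: its state and the whiteboard of its node are updated, and the node
to which it wants to migrate (if any) is recorded in the second component. -/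
noncomputable def execute [Fintype V] (M : Variant) (N : Network V) (info : Fin k → I)
    (s : Config A V k × (Fin k → Option V)) (i : Fin k) : Config A V k × (Fin k → Option V) :=
  let a := A.act (view M N info s.1 i)
  ({ s.1 with
      mem := Function.update s.1.mem i a.mem
      board := Function.update s.1.board (s.1.pos i) a.board },
    Function.update s.2 i (a.move.bind (N.dest (s.1.pos i))))

/-- The action part of a round: all the agents execute their actions, one after the other, in the
given order. -/
noncomputable def actionPhase [Fintype V] (M : Variant) (N : Network V) (info : Fin k → I)
    (order : Equiv.Perm (Fin k)) (c : Config A V k) : Config A V k × (Fin k → Option V) :=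
  ((List.finRange k).map order).foldl (execute M N info) (c, fun _ => none)

/-- Agent `i` succeeds in migrating to `w`: it wants to, and if links are half-duplex and some agent
at `w` simultaneously wants to use the same link in the opposite direction, then the direction from
the node of `i` to `w` is the one that prevails. -/
def Crosses (M : Variant) (prevails : V → V → Prop) (s : Config A V k × (Fin k → Option V))
    (i : Fin k) (w : V) : Prop :=
  s.2 i = some w ∧
    (M.halfDuplex = true → (∃ j, s.1.pos j = w ∧ s.2 j = some (s.1.pos i)) →
      prevails (s.1.pos i) w)

open scoped Classical in
/-- The migration part of a round: all successful migrations take place simultaneously, and all the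
other agents stay where they are. -/
noncomputable def migrationPhase (M : Variant) (N : Network V) (prevails : V → V → Prop)
    (s : Config A V k × (Fin k → Option V)) : Config A V k where
  pos i := if h : ∃ w, Crosses M prevails s i w then h.choose else s.1.pos i
  mem := s.1.mem
  moved i := decide (∃ w, Crosses M prevails s i w)
  inLabel i := if h : ∃ w, Crosses M prevails s i w then
    some (N.label h.choose (s.1.pos i)) else s.1.inLabel i
  board := s.1.board

/-- `c'` can be reached from `c` in one synchronous round. The order in which co-located agents act,
and the direction that prevails on each half-duplex link in case of a conflict, are arbitrary. -/
def Round [Fintype V] (M : Variant) (N : Network V) (info : Fin k → I) (c c' : Config A V k) :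
    Prop :=
  ∃ (order : Equiv.Perm (Fin k)) (prevails : V → V → Prop),
    (∀ u w, u ≠ w → (prevails u w ↔ ¬ prevails w u)) ∧
    c' = migrationPhase M N prevails (actionPhase M N info order c)

/-- An execution, from an arbitrary initial configuration. -/
def IsExecution [Fintype V] (M : Variant) (N : Network V) (info : Fin k → I)
    (c : ℕ → Config A V k) : Prop :=
  ∀ t, Round M N info (c t) (c (t + 1))

end Round

/-- The algorithm `A` is a self-stabilizing solution to the gossip problem, the number of agents
being unknown to it: on every network, for every number of agents and every assignment of gossip
information, in every execution (from any initial configuration) every agent eventually knows, for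
ever, the gossip information of all the agents. -/
def SolvesGossip {I : Type} (M : Variant) (A : Algorithm I) : Prop :=
  ∀ (V : Type) [Fintype V] (N : Network V) (k : ℕ) (info : Fin k → I) (c : ℕ → Config A V k),
    IsExecution M N info c → ∃ T, ∀ t ≥ T, ∀ i j, info j ∈ ((c t).mem i).known

/-- `A` is `l`-quiescent with `k` agents: every execution of `k` agents reaches a configuration after
which at least `l` agents remain still forever. -/
def IsQuiescent {I : Type} (M : Variant) (A : Algorithm I) (k l : ℕ) : Prop :=
  ∀ (V : Type) [Fintype V] (N : Network V) (info : Fin k → I) (c : ℕ → Config A V k),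
    IsExecution M N info c →
      ∃ (T : ℕ) (S : Finset (Fin k)), l ≤ S.card ∧ ∀ i ∈ S, ∀ t ≥ T, (c t).pos i = (c T).pos i

/-- `q` is the quiescence number of the `k`-gossip problem among anonymous agents (with gossip
information from `I`) in the synchronous model with full whiteboards: the maximum `l` such that an
`l`-quiescent self-stabilizing solution exists, or `-1` if there is none. -/
def IsQuiescenceNumber (I : Type) (M : Variant) (k : ℕ) (q : ℤ) : Prop :=
  IsGreatest
    (insert (-1) {z : ℤ | ∃ l : ℕ, z = l ∧
      ∃ A : Algorithm I, SolvesGossip M A ∧ IsQuiescent M A k l}) q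

end MobileAgents

/-! Lower bound. Every algorithm is 0-quiescent, so one self-stabilizing solution suffices, and
`rotor` is one. A counter on each whiteboard selects the requested link so that every label recurs
infinitely often. On a half-duplex link a given direction may be starved forever, but a requested
link is always crossed in one direction or the other. Hence the recurrently occupied nodes form a
nonempty set without boundary: every node is recurrent (`IsExecution.recurrent`). A set of nodes
that is never left would gain agents without bound, so every proper nonempty set is left infinitely
often (`IsExecution.exists_leaving`). Applied to the nodes whose whiteboards know a given piece,
this spreads the piece everywhere.

Upper bound. Suppose all `k` agents become still. Run them on the complete network with `k + 1`
nodes and no gossip in memory, once with everybody's piece equal to `y` and once with `z ≠ y`. Each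
still configuration has an empty node; link the two empty nodes. No agent ever stands where the new
link is visible, so the `2k` agents behave as in the separate copies and never exchange gossip
(`Joined.run`). This contradicts correctness with `2k` agents, which is required since the number of
agents is unknown to the algorithm. -/

namespace MobileAgents

variable {I V : Type} {k : ℕ}

/-! ### Links and connectivity of networks. -/

namespace Network

theorem dest_eq_some_iff (N : Network V) {v w : V} {p : ℕ} :
    N.dest v p = some w ↔ N.graph.Adj v w ∧ N.label v w = p := by
  unfold dest
  split_ifs with h
  · have hs := h.choose_spec
    constructor
    · intro e
      obtain rfl := Option.some.inj e
      exact hs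
    · rintro ⟨ha, hl⟩
      exact congrArg some (N.label_injective _ _ _ hs.1 ha (hs.2.trans hl.symm))
  · simp only [false_iff]
    exact fun hw => h ⟨w, hw⟩

theorem dest_label (N : Network V) {v w : V} (h : N.graph.Adj v w) :
    N.dest v (N.label v w) = some w :=
  N.dest_eq_some_iff.2 ⟨h, rfl⟩

/-- A proper nonempty set of nodes has an outgoing link. -/
theorem exists_adj_boundary (N : Network V) {S : Set V} {a b : V} (ha : a ∈ S) (hb : b ∉ S) :
    ∃ u ∈ S, ∃ v ∉ S, N.graph.Adj u v := by
  obtain ⟨p⟩ := N.connected.preconnected a b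
  obtain ⟨d, _, h1, h2⟩ := p.exists_boundary_dart S ha hb
  exact ⟨d.fst, h1, d.snd, h2, d.adj⟩

end Network

/-! ### Requests and migrations in one round of an arbitrary algorithm. -/

theorem migrationPhase_pos_of_crosses {A : Algorithm I} {M : Variant} {N : Network V}
    {prevails : V → V → Prop}
    {s : Config A V k × (Fin k → Option V)} {i : Fin k} {w : V} (h : Crosses M prevails s i w) :
    (migrationPhase M N prevails s).pos i = w := by
  have hex : ∃ w, Crosses M prevails s i w := ⟨w, h⟩
  have hs := hex.choose_spec.1
  simp only [migrationPhase, dif_pos hex]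
  exact Option.some.inj (hs.symm.trans h.1)

section Fold

variable [Fintype V] {A : Algorithm I} {M : Variant} {N : Network V} {info : Fin k → I}

theorem foldl_execute_pos (L : List (Fin k)) (s : Config A V k × (Fin k → Option V)) :
    (L.foldl (execute M N info) s).1.pos = s.1.pos := by
  induction L generalizing s with
  | nil => rfl
  | cons i L ih => exact ih _

@[simp]
theorem actionPhase_pos (order : Equiv.Perm (Fin k)) (c : Config A V k) :
    (actionPhase M N info order c).1.pos = c.pos :=
  foldl_execute_pos _ _

theorem foldl_execute_request_of_notMem {L : List (Fin k)} {i : Fin k} (hi : i ∉ L)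
    (s : Config A V k × (Fin k → Option V)) :
    (L.foldl (execute M N info) s).2 i = s.2 i := by
  induction L generalizing s with
  | nil => rfl
  | cons j L ih =>
    rw [List.mem_cons, not_or] at hi
    rw [List.foldl_cons, ih hi.2]
    exact Function.update_of_ne hi.1 _ _

theorem adj_of_foldl_execute_request (L : List (Fin k))
    (s : Config A V k × (Fin k → Option V))
    (hs : ∀ i w, s.2 i = some w → N.graph.Adj (s.1.pos i) w) (i : Fin k) (w : V)
    (h : (L.foldl (execute M N info) s).2 i = some w) : N.graph.Adj (s.1.pos i) w := by
  induction L generalizing s with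
  | nil => exact hs i w h
  | cons j L ih =>
    refine ih (execute M N info s j) (fun l x hl => ?_) h
    by_cases hlj : l = j
    · subst hlj
      simp only [execute, Function.update_self, Option.bind_eq_some_iff] at hl
      obtain ⟨p, -, hp⟩ := hl
      exact (N.dest_eq_some_iff.1 hp).1
    · simp only [execute, Function.update_of_ne hlj] at hl
      exact hs l x hl

theorem adj_of_actionPhase_request {order : Equiv.Perm (Fin k)} {c : Config A V k} {i : Fin k}
    {w : V} (h : (actionPhase M N info order c).2 i = some w) : N.graph.Adj (c.pos i) w :=
  adj_of_foldl_execute_request _ (c, fun _ => none) (by simp) i w h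

/-- If an agent requests a link, then that link is crossed, in one direction or the other. -/
theorem exists_crossing_of_request {order : Equiv.Perm (Fin k)} {prevails : V → V → Prop}
    (hp : ∀ u w, u ≠ w → (prevails u w ↔ ¬ prevails w u)) {c : Config A V k} {i : Fin k} {w : V}
    (h : (actionPhase M N info order c).2 i = some w) :
    (migrationPhase M N prevails (actionPhase M N info order c)).pos i = w ∨
      ∃ j, c.pos j = w ∧
        (migrationPhase M N prevails (actionPhase M N info order c)).pos j = c.pos i := by
  have hne := (adj_of_actionPhase_request h).ne
  by_cases hc : Crosses M prevails (actionPhase M N info order c) i w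
  · exact Or.inl (migrationPhase_pos_of_crosses hc)
  · right
    simp only [Crosses, h, true_and, actionPhase_pos, not_forall] at hc
    -- Agent `i` can fail only because of an opposite request by some `j` at `w` whose direction
    -- prevails; then `j` crosses.
    obtain ⟨-, ⟨j, hj, hjr⟩, hnp⟩ := hc
    refine ⟨j, hj, migrationPhase_pos_of_crosses ⟨hjr, fun _ _ => ?_⟩⟩
    rw [actionPhase_pos, hj]
    exact (hp _ _ hne.symm).2 hnp

end Fold

/-! ### The rotor algorithm: one round. -/

section Rotor

open scoped Classical in
/-- The rotor algorithm. The whiteboard holds a counter, which is incremented by every action; its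
value determines the label of the link that is requested, in such a way that every label keeps
returning. All the gossip information at hand is collected by the agent and the whiteboard. -/
noncomputable def rotor (I : Type) : Algorithm I where
  Ctrl := Unit
  BoardCtrl := ℕ
  ctrl_nonempty := inferInstance
  boardCtrl_nonempty := inferInstance
  act v :=
    { mem := ⟨(), insert v.own (v.mem.known ∪ v.board.known)⟩
      board := ⟨v.board.ctrl + 1, insert v.own (v.mem.known ∪ v.board.known)⟩
      move := some v.board.ctrl.unpair.1 }
  mem_available v x hx := by
    simp only [Finset.mem_insert, Finset.mem_union] at hx
    simp only [View.available, Set.mem_ofPred_eq]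
    tauto
  board_available v x hx := by
    simp only [Finset.mem_insert, Finset.mem_union] at hx
    simp only [View.available, Set.mem_ofPred_eq]
    tauto

/-- The value of the counter on the whiteboard of `v`. -/
def counter (c : Config (rotor I) V k) (v : V) : ℕ := (c.board v).ctrl

/-- Nothing is forgotten, and no counter is decreased, between `c` and `c'`. -/
structure Grows (c c' : Config (rotor I) V k) : Prop where
  mem : ∀ i, (c.mem i).known ⊆ (c'.mem i).known
  board : ∀ v, (c.board v).known ⊆ (c'.board v).known
  counter : ∀ v, counter c v ≤ counter c' v

theorem Grows.refl (c : Config (rotor I) V k) : Grows c c :=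
  ⟨fun _ => subset_rfl, fun _ => subset_rfl, fun _ => le_rfl⟩

theorem Grows.trans {c c' c'' : Config (rotor I) V k} (h : Grows c c') (h' : Grows c' c'') :
    Grows c c'' :=
  ⟨fun i => (h.mem i).trans (h'.mem i), fun v => (h.board v).trans (h'.board v),
    fun v => (h.counter v).trans (h'.counter v)⟩

variable [Fintype V] {M : Variant} {N : Network V} {info : Fin k → I}

open scoped Classical in
/-- The gossip information held by an agent and by its whiteboard after an action of `rotor`. -/
noncomputable def collected (info : Fin k → I) (c : Config (rotor I) V k) (i : Fin k) : Finset I :=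
  insert (info i) ((c.mem i).known ∪ (c.board (c.pos i)).known)

theorem execute_rotor_mem_self (s : Config (rotor I) V k × (Fin k → Option V)) (i : Fin k) :
    (((execute M N info s i).1.mem i).known) = collected info s.1 i := by
  simp [execute, rotor, view, collected]

theorem execute_rotor_board_self (s : Config (rotor I) V k × (Fin k → Option V)) (i : Fin k) :
    (((execute M N info s i).1.board (s.1.pos i)).known) = collected info s.1 i := by
  simp [execute, rotor, view, collected]

theorem counter_execute_self (s : Config (rotor I) V k × (Fin k → Option V)) (i : Fin k) :
    counter (execute M N info s i).1 (s.1.pos i) = counter s.1 (s.1.pos i) + 1 := by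
  simp [execute, rotor, view, counter]

theorem counter_execute_of_ne (s : Config (rotor I) V k × (Fin k → Option V)) {i : Fin k} {v : V}
    (h : v ≠ s.1.pos i) : counter (execute M N info s i).1 v = counter s.1 v := by
  classical
  exact congrArg Memory.ctrl (Function.update_of_ne h _ _)

theorem request_execute_self (s : Config (rotor I) V k × (Fin k → Option V)) (i : Fin k) :
    (execute M N info s i).2 i =
      N.dest (s.1.pos i) (counter s.1 (s.1.pos i)).unpair.1 := by
  simp [execute, rotor, view, counter]

theorem grows_execute (s : Config (rotor I) V k × (Fin k → Option V)) (i : Fin k) :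
    Grows s.1 (execute M N info s i).1 where
  mem j := by
    classical
    by_cases h : j = i
    · subst h
      rw [execute_rotor_mem_self]
      exact fun x hx => Finset.mem_insert_of_mem (Finset.mem_union_left _ hx)
    · simp [execute, Function.update_of_ne h]
  board v := by
    classical
    by_cases h : v = s.1.pos i
    · subst h
      rw [execute_rotor_board_self]
      exact fun x hx => Finset.mem_insert_of_mem (Finset.mem_union_right _ hx)
    · simp [execute, Function.update_of_ne h]
  counter v := by
    by_cases h : v = s.1.pos i
    · subst h
      rw [counter_execute_self]
      exact Nat.le_succ _
    · rw [counter_execute_of_ne s h]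

theorem grows_foldl (L : List (Fin k)) (s : Config (rotor I) V k × (Fin k → Option V)) :
    Grows s.1 (L.foldl (execute M N info) s).1 := by
  induction L generalizing s with
  | nil => exact Grows.refl _
  | cons i L ih => exact (grows_execute s i).trans (ih _)

/-- Agent `i` acts at some point of the action phase. -/
theorem exists_execute (order : Equiv.Perm (Fin k)) (c : Config (rotor I) V k) (i : Fin k) :
    ∃ s : Config (rotor I) V k × (Fin k → Option V), s.1.pos = c.pos ∧ Grows c s.1 ∧
      Grows (execute M N info s i).1 (actionPhase M N info order c).1 := by
  have hi : i ∈ (List.finRange k).map order :=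
    List.mem_map.2 ⟨order.symm i, List.mem_finRange _, order.apply_symm_apply i⟩
  obtain ⟨L₁, L₂, hL⟩ := List.append_of_mem hi
  -- The state just before `i` acts, reached after the agents that precede `i` in the order.
  refine ⟨L₁.foldl (execute M N info) (c, fun _ => none), foldl_execute_pos _ _,
    grows_foldl L₁ (c, fun _ => none), ?_⟩
  rw [actionPhase, hL, List.foldl_append, List.foldl_cons]
  exact grows_foldl _ _

/-- Each action at `v` raises the counter by exactly one, so the passed value `a` was read by some
agent there. As `L` has no duplicates, that agent does not act again and its request survives. -/
theorem exists_request_foldl {L : List (Fin k)} (hL : L.Nodup)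
    (s : Config (rotor I) V k × (Fin k → Option V)) {v : V} {a : ℕ} (ha : counter s.1 v ≤ a)
    (ha' : a < counter (L.foldl (execute M N info) s).1 v) :
    ∃ i, s.1.pos i = v ∧ (L.foldl (execute M N info) s).2 i = N.dest v a.unpair.1 := by
  induction L generalizing s with
  | nil => exact absurd ha' ha.not_gt
  | cons i L ih =>
    rw [List.nodup_cons] at hL
    rw [List.foldl_cons] at ha' ⊢
    by_cases h : counter (execute M N info s i).1 v ≤ a
    · exact ih hL.2 (execute M N info s i) h ha'
    · have hv : v = s.1.pos i := by
        by_contra hne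
        rw [counter_execute_of_ne s hne] at h
        exact h ha
      subst hv
      rw [counter_execute_self] at h
      obtain rfl : a = counter s.1 (s.1.pos i) := by omega
      exact ⟨i, rfl, by rw [foldl_execute_request_of_notMem hL.1, request_execute_self]⟩

variable {c c' : Config (rotor I) V k}

theorem Round.grows (h : Round M N info c c') : Grows c c' := by
  obtain ⟨order, prevails, -, rfl⟩ := h
  have hg := grows_foldl (M := M) (N := N) (info := info) ((List.finRange k).map order)
    (c, fun _ => none)
  exact ⟨hg.mem, hg.board, hg.counter⟩

theorem Round.counter_lt (h : Round M N info c c') (i : Fin k) :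
    counter c (c.pos i) < counter c' (c.pos i) := by
  obtain ⟨order, prevails, -, rfl⟩ := h
  obtain ⟨s, hs, h1, h2⟩ := exists_execute (M := M) (N := N) (info := info) order c i
  have h3 := h2.counter (s.1.pos i)
  rw [counter_execute_self, hs] at h3
  exact (Nat.lt_succ_of_le (h1.counter _)).trans_le h3

theorem Round.info_mem_board (h : Round M N info c c') (i : Fin k) :
    info i ∈ (c'.board (c.pos i)).known := by
  classical
  obtain ⟨order, prevails, -, rfl⟩ := h
  obtain ⟨s, hs, h1, h2⟩ := exists_execute (M := M) (N := N) (info := info) order c i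
  have h3 := h2.board (s.1.pos i)
  rw [execute_rotor_board_self, hs] at h3
  exact h3 (Finset.mem_insert_self _ _)

theorem Round.mem_subset_board (h : Round M N info c c') (i : Fin k) :
    (c.mem i).known ⊆ (c'.board (c.pos i)).known := by
  classical
  obtain ⟨order, prevails, -, rfl⟩ := h
  obtain ⟨s, hs, h1, h2⟩ := exists_execute (M := M) (N := N) (info := info) order c i
  have h3 := h2.board (s.1.pos i)
  rw [execute_rotor_board_self, hs] at h3
  exact fun x hx => h3 (Finset.mem_insert_of_mem (Finset.mem_union_left _ (h1.mem i hx)))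

theorem Round.board_subset_mem (h : Round M N info c c') (i : Fin k) :
    (c.board (c.pos i)).known ⊆ (c'.mem i).known := by
  classical
  obtain ⟨order, prevails, -, rfl⟩ := h
  obtain ⟨s, hs, h1, h2⟩ := exists_execute (M := M) (N := N) (info := info) order c i
  have h3 := h2.mem i
  rw [execute_rotor_mem_self] at h3
  refine fun x hx => h3 (Finset.mem_insert_of_mem (Finset.mem_union_right _ ?_))
  rw [hs]
  exact h1.board _ hx

/-- When the counter of `u` passes a value that selects the link `uv`, this link is crossed. -/
theorem Round.exists_crossing (h : Round M N info c c') {u v : V} (huv : N.graph.Adj u v) {a : ℕ}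
    (hl : a.unpair.1 = N.label u v) (ha : counter c u ≤ a) (ha' : a < counter c' u) :
    (∃ i, c.pos i = u ∧ c'.pos i = v) ∨ ∃ i, c.pos i = v ∧ c'.pos i = u := by
  obtain ⟨order, prevails, hp, rfl⟩ := h
  obtain ⟨i, hi, hr⟩ := exists_request_foldl (M := M) (N := N) (info := info)
    ((List.nodup_finRange k).map order.injective) (c, fun _ => none) ha ha'
  rw [hl, N.dest_label huv] at hr
  simp only at hi
  subst hi
  rcases exists_crossing_of_request hp hr with h | h
  · exact Or.inl ⟨i, rfl, h⟩
  · exact Or.inr h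

end Rotor

/-! ### The rotor algorithm: long-term behaviour and correctness. -/

section RotorExecution

variable [Fintype V] {M : Variant} {N : Network V} {info : Fin k → I}
  {c : ℕ → Config (rotor I) V k}

/-- The node `v` is occupied infinitely often. -/
def Recurrent {A : Algorithm I} (c : ℕ → Config A V k) (v : V) : Prop :=
  ∀ T, ∃ t ≥ T, ∃ i, (c t).pos i = v

theorem IsExecution.grows (h : IsExecution M N info c) {s t : ℕ} (hst : s ≤ t) :
    Grows (c s) (c t) := by
  induction hst with
  | refl => exact Grows.refl _
  | step _ ih => exact ih.trans (h _).grows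

theorem IsExecution.exists_le_counter (h : IsExecution M N info c) {v : V} (hv : Recurrent c v)
    (n : ℕ) : ∃ t, n ≤ counter (c t) v := by
  induction n with
  | zero => exact ⟨0, Nat.zero_le _⟩
  | succ n ih =>
    obtain ⟨t, ht⟩ := ih
    obtain ⟨t', htt', i, rfl⟩ := hv t
    exact ⟨t' + 1, (ht.trans ((h.grows htt').counter _)).trans_lt ((h t').counter_lt i)⟩

/-- A link at a recurrent node is crossed infinitely often, in one direction or the other. -/
theorem IsExecution.exists_crossing (h : IsExecution M N info c) {u v : V} (hu : Recurrent c u)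
    (huv : N.graph.Adj u v) (T : ℕ) :
    ∃ t ≥ T, (∃ i, (c t).pos i = u ∧ (c (t + 1)).pos i = v) ∨
      ∃ i, (c t).pos i = v ∧ (c (t + 1)).pos i = u := by
  classical
  -- The first component of `a` selects the link `uv`; the second ensures that the counter has not
  -- passed `a` by time `T`.
  set a := Nat.pair (N.label u v) (counter (c T) u) with ha
  have hTa : counter (c T) u ≤ a := Nat.right_le_pair _ _
  obtain ⟨t₁, ht₁⟩ := h.exists_le_counter hu (a + 1)
  have hex : ∃ t, a < counter (c t) u := ⟨t₁, ht₁⟩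
  have hspec := Nat.find_spec hex
  have hT : T < Nat.find hex := by
    by_contra hle
    exact absurd (hspec.trans_le ((h.grows (not_lt.1 hle)).counter u)) hTa.not_gt
  -- The round from `t` to `t + 1` is the one in which the counter passes `a`.
  obtain ⟨t, ht⟩ : ∃ t, Nat.find hex = t + 1 := ⟨Nat.find hex - 1, by omega⟩
  have hlt : ¬ a < counter (c t) u := Nat.find_min hex (by omega)
  rw [ht] at hspec
  exact ⟨t, by omega, (h t).exists_crossing huv (by rw [ha, Nat.unpair_pair]) (not_lt.1 hlt) hspec⟩

/-- Agent `i` is always somewhere and there are finitely many nodes, so some node is recurrent. A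
link from a recurrent to a non-recurrent node would be crossed infinitely often, and either
direction of crossing puts an agent on the latter. -/
theorem IsExecution.recurrent (h : IsExecution M N info c) (i : Fin k) (v : V) :
    Recurrent c v := by
  by_contra hv
  obtain ⟨u, hu⟩ : ∃ u, Recurrent c u := by
    by_contra hne
    simp only [Recurrent, not_exists, not_forall, not_and] at hne
    choose T hT using hne
    obtain ⟨B, hB⟩ := (Set.finite_range T).bddAbove
    exact hT _ B (hB ⟨_, rfl⟩) i rfl
  obtain ⟨u, hu, w, hw, huw⟩ := N.exists_adj_boundary (S := {v | Recurrent c v}) hu hv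
  refine hw fun T => ?_
  obtain ⟨t, ht, ⟨j, -, hj⟩ | ⟨j, hj, -⟩⟩ := h.exists_crossing hu huw T
  · exact ⟨t + 1, by omega, j, hj⟩
  · exact ⟨t, ht, j, hj⟩

/-- No proper nonempty set of nodes is left only finitely often. -/
theorem IsExecution.exists_leaving (h : IsExecution M N info c) (j : Fin k) {S : Set V} {a b : V}
    (ha : a ∈ S) (hb : b ∉ S) (T : ℕ) :
    ∃ t ≥ T, ∃ i, (c t).pos i ∈ S ∧ (c (t + 1)).pos i ∉ S := by
  by_contra hno
  push Not at hno
  -- If nobody leaves `S`, the set of agents inside increases and becomes constant. A boundary link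
  -- is crossed even later: outwards is excluded, and inwards would enlarge the constant set.
  let inside : ℕ → Set (Fin k) := fun t => {i | (c (T + t)).pos i ∈ S}
  have hmono : Monotone inside :=
    monotone_nat_of_le_succ fun t i hi => hno (T + t) (Nat.le_add_right _ _) i hi
  obtain ⟨n, hn⟩ := WellFoundedGT.monotone_chain_condition ⟨inside, hmono⟩
  obtain ⟨u, hu, v, hv, huv⟩ := N.exists_adj_boundary ha hb
  obtain ⟨t, ht, ⟨i, hi, hi'⟩ | ⟨i, hi, hi'⟩⟩ :=
    h.exists_crossing (h.recurrent j u) huv (T + n)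
  · exact hv (hi' ▸ hno t (by omega) i (hi ▸ hu))
  · obtain ⟨m, rfl⟩ : ∃ m, t = T + m := ⟨t - T, by omega⟩
    have h1 : inside n = inside m := hn m (by omega)
    have h2 : inside n = inside (m + 1) := hn (m + 1) (by omega)
    have h3 : i ∈ inside (m + 1) := by
      change (c (T + m + 1)).pos i ∈ S
      rwa [hi']
    rw [← h2, h1] at h3
    exact hv (hi ▸ h3)

/-- The set of nodes whose whiteboards know the piece increases and stabilizes. Were it proper, an
agent would later leave it, having read the piece, and write it on a whiteboard outside. -/
theorem IsExecution.eventually_board (h : IsExecution M N info c) (j : Fin k) :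
    ∃ T, ∀ t ≥ T, ∀ v, info j ∈ ((c t).board v).known := by
  let S : ℕ → Set V := fun t => {v | info j ∈ ((c t).board v).known}
  have hmono : Monotone S := fun s t hst v hv => (h.grows hst).board v hv
  obtain ⟨n, hn⟩ := WellFoundedGT.monotone_chain_condition ⟨S, hmono⟩
  replace hn : ∀ m, n ≤ m → S n = S m := hn
  have hmem : (c n).pos j ∈ S n := by
    rw [hn (n + 1) (by omega)]
    exact (h n).info_mem_board j
  suffices hall : ∀ v, v ∈ S n from
    ⟨n, fun t ht v => (h.grows ht).board v (hall v)⟩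
  by_contra! hne
  obtain ⟨b, hb⟩ := hne
  obtain ⟨t, ht, i, hi, hi'⟩ := h.exists_leaving j hmem hb n
  rw [hn t ht] at hi
  -- Two rounds are needed: the agent reads and migrates in round `t`, and writes at its new node in
  -- round `t + 1`.
  rw [hn (t + 2) (by omega)] at hi'
  exact hi' ((h (t + 1)).mem_subset_board i ((h t).board_subset_mem i hi))

end RotorExecution

theorem solvesGossip_rotor (I : Type) (M : Variant) : SolvesGossip M (rotor I) := by
  intro V _ N k info c h
  choose T hT using fun j => h.eventually_board j
  obtain ⟨B, hB⟩ := (Set.finite_range T).bddAbove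
  -- The additional round lets each agent copy the whiteboard of its node.
  refine ⟨B + 1, fun t ht i j => ?_⟩
  obtain ⟨t, rfl⟩ : ∃ s, t = s + 1 := ⟨t - 1, by omega⟩
  exact (h t).board_subset_mem i (hT j t ((hB ⟨j, rfl⟩).trans (by omega)) _)

theorem isQuiescent_zero (M : Variant) (A : Algorithm I) (k : ℕ) : IsQuiescent M A k 0 :=
  fun _ _ _ _ _ _ => ⟨0, ∅, le_rfl, by simp⟩

/-! ### A canonical execution, and the confinement of gossip. -/

section Run

variable {I V : Type} {k : ℕ} {A : Algorithm I} {M : Variant} {N : Network V}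

theorem wellOrderingRel_iff_not {u w : V} (h : u ≠ w) :
    WellOrderingRel u w ↔ ¬ WellOrderingRel w u := by
  constructor
  · exact fun h₁ h₂ => asymm_of WellOrderingRel h₁ h₂
  · intro h₁
    rcases trichotomous_of WellOrderingRel u w with h₂ | h₂ | h₂
    · exact h₂
    · exact absurd h₂ h
    · exact absurd h₂ h₁

theorem migrationPhase_eq_of_request_eq_none {prevails : V → V → Prop}
    {s : Config A V k × (Fin k → Option V)} (h : ∀ i, s.2 i = none) :
    migrationPhase M N prevails s = { s.1 with moved := fun _ => false } := by
  have hn : ∀ i, ¬ ∃ w, Crosses M prevails s i w := by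
    rintro i ⟨w, hw, -⟩
    simp [h i] at hw
  simp [migrationPhase, hn]

/-- No agent and no whiteboard holds a piece of gossip information other than `x`. -/
structure OnlyKnows (x : I) (c : Config A V k) : Prop where
  mem : ∀ i, ∀ y ∈ (c.mem i).known, y = x
  board : ∀ v, ∀ y ∈ (c.board v).known, y = x

/-- Every algorithm has a configuration in which all the memories are devoid of gossip. -/
theorem exists_onlyKnows (A : Algorithm I) (x : I) (v : V) : ∃ c : Config A V k, OnlyKnows x c := by
  obtain ⟨q⟩ := A.ctrl_nonempty
  obtain ⟨r⟩ := A.boardCtrl_nonempty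
  exact ⟨⟨fun _ => v, fun _ => ⟨q, ∅⟩, fun _ => false, fun _ => none, fun _ => ⟨r, ∅⟩⟩,
    by simp, by simp⟩

variable [Fintype V] {info : Fin k → I}

/-- A particular execution: agents act in the order of their indices, and conflicts on half-duplex
links are decided by a fixed linear order on the nodes. -/
noncomputable def run (M : Variant) (N : Network V) (info : Fin k → I) (c : Config A V k) :
    ℕ → Config A V k
  | 0 => c
  | t + 1 => migrationPhase M N WellOrderingRel (actionPhase M N info 1 (run M N info c t))

theorem isExecution_run (c : Config A V k) : IsExecution M N info (run M N info c) :=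
  fun _ => ⟨1, WellOrderingRel, fun _ _ => wellOrderingRel_iff_not, rfl⟩

/-- Gossip cannot be made up: if only `x` is given or stored anywhere, only `x` is available to an
action. -/
theorem OnlyKnows.execute {x : I} {s : Config A V k × (Fin k → Option V)}
    (h : OnlyKnows x s.1) (hx : ∀ i, info i = x) (i : Fin k) :
    OnlyKnows x (execute M N info s i).1 := by
  classical
  have hav : ∀ y ∈ (view M N info s.1 i).available, y = x := by
    rintro y (hy | hy | hy | ⟨m, hm, hy⟩)
    · exact hy.trans (hx i)
    · exact h.mem i y hy
    · exact h.board _ y hy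
    · simp only [view, Multiset.mem_map] at hm
      obtain ⟨j, -, rfl⟩ := hm
      exact h.mem j y hy
  refine ⟨fun j y hy => ?_, fun v y hy => ?_⟩
  · by_cases hj : j = i
    · subst hj
      simp only [MobileAgents.execute, Function.update_self] at hy
      exact hav y (A.mem_available _ y hy)
    · simp only [MobileAgents.execute, Function.update_of_ne hj] at hy
      exact h.mem j y hy
  · by_cases hv : v = s.1.pos i
    · subst hv
      simp only [MobileAgents.execute, Function.update_self] at hy
      exact hav y (A.board_available _ y hy)
    · simp only [MobileAgents.execute, Function.update_of_ne hv] at hy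
      exact h.board v y hy

theorem OnlyKnows.foldl {x : I} (L : List (Fin k)) {s : Config A V k × (Fin k → Option V)}
    (h : OnlyKnows x s.1) (hx : ∀ i, info i = x) :
    OnlyKnows x (L.foldl (MobileAgents.execute M N info) s).1 := by
  induction L generalizing s with
  | nil => exact h
  | cons i L ih => exact ih (h.execute hx i)

theorem OnlyKnows.run {x : I} {c : Config A V k} (h : OnlyKnows x c) (hx : ∀ i, info i = x)
    (t : ℕ) : OnlyKnows x (run M N info c t) := by
  induction t with
  | zero => exact h
  | succ t ih =>
    have h' := OnlyKnows.foldl (M := M) (N := N) ((List.finRange k).map (1 : Equiv.Perm (Fin k)))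
      (s := (MobileAgents.run M N info c t, fun _ => none)) ih hx
    exact ⟨h'.mem, h'.board⟩

/-- If no agent moves in a round, then no agent requests a link. -/
theorem request_eq_none {order : Equiv.Perm (Fin k)} {prevails : V → V → Prop}
    (hp : ∀ u w, u ≠ w → (prevails u w ↔ ¬ prevails w u)) {c : Config A V k}
    (h : (migrationPhase M N prevails (actionPhase M N info order c)).pos = c.pos) (i : Fin k) :
    (actionPhase M N info order c).2 i = none := by
  by_contra hne
  obtain ⟨w, hw⟩ := Option.ne_none_iff_exists'.1 hne
  have hiw := (adj_of_actionPhase_request hw).ne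
  rcases exists_crossing_of_request hp hw with h' | ⟨j, hj, h'⟩
  · rw [h] at h'
    exact hiw h'
  · rw [h, hj] at h'
    exact hiw h'.symm

end Run

/-! ### Two complete networks joined by a link. -/

/-- The complete network with `n + 1` nodes. -/
def completeNetwork (n : ℕ) : Network (Fin (n + 1)) where
  graph := ⊤
  connected := SimpleGraph.connected_top
  label _ w := w
  label_injective _ _ _ _ _ h := Fin.ext h

/-- The adjacency relation of two complete graphs with a link between the nodes `u false` and
`u true` of the two. -/
def joinedGraph {n : ℕ} (u : Bool → Fin (n + 1)) : SimpleGraph (Bool × Fin (n + 1)) where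
  Adj x y := (x.1 = y.1 ∧ x.2 ≠ y.2) ∨ (x.1 ≠ y.1 ∧ x.2 = u x.1 ∧ y.2 = u y.1)
  symm := ⟨fun x y h => h.imp (fun h => ⟨h.1.symm, h.2.symm⟩) fun h => ⟨h.1.symm, h.2.2, h.2.1⟩⟩
  loopless := ⟨fun x h => by simp at h⟩

theorem joinedGraph_connected {n : ℕ} (u : Bool → Fin (n + 1)) : (joinedGraph u).Connected := by
  have h₁ : ∀ b v, (joinedGraph u).Reachable (b, v) (b, u b) := by
    intro b v
    by_cases h : v = u b
    · rw [h]
    · exact SimpleGraph.Adj.reachable (Or.inl ⟨rfl, h⟩)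
  have h₂ : ∀ b b', (joinedGraph u).Reachable (b, u b) (b', u b') := by
    intro b b'
    by_cases h : b = b'
    · rw [h]
    · exact SimpleGraph.Adj.reachable (Or.inr ⟨h, rfl, rfl⟩)
  exact ⟨fun x y => (h₁ _ _).trans ((h₂ _ _).trans (h₁ _ _).symm)⟩

/-- Two complete networks with a link between the nodes `u false` and `u true` of the two. -/
def joinedNetwork {n : ℕ} (u : Bool → Fin (n + 1)) : Network (Bool × Fin (n + 1)) where
  graph := joinedGraph u
  connected := joinedGraph_connected u
  -- Labels inside a copy are at most `n`, so `n + 1` is free for the joining link.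
  label x y := if x.1 = y.1 then y.2 else n + 1
  label_injective := by
    rintro ⟨b, v⟩ ⟨b₁, w₁⟩ ⟨b₂, w₂⟩ (⟨h₁, -⟩ | ⟨h₁, -, h₁'⟩) (⟨h₂, -⟩ | ⟨h₂, -, h₂'⟩) h
    · simp only at h₁ h₂
      subst h₁ h₂
      simpa [Fin.ext_iff] using h
    · simp only at h₁ h₂
      subst h₁
      simp only [if_true, if_neg h₂] at h
      omega
    · simp only at h₁ h₂
      subst h₂
      simp only [if_true, if_neg h₁] at h
      omega
    · simp only at h₁ h₂ h₁' h₂'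
      obtain rfl : b₁ = b₂ := by
        cases b <;> cases b₁ <;> cases b₂ <;> simp_all
      rw [h₁', h₂']

section Joined

variable {I : Type} {A : Algorithm I} {M : Variant} {n k : ℕ} {u : Bool → Fin (n + 1)}

theorem joinedNetwork_adj {b : Bool} {v : Fin (n + 1)} (hv : v ≠ u b) (y : Bool × Fin (n + 1)) :
    (joinedNetwork u).graph.Adj (b, v) y ↔ ∃ w, (b, w) = y ∧ (completeNetwork n).graph.Adj v w := by
  obtain ⟨b', w⟩ := y
  simp only [joinedNetwork, joinedGraph, completeNetwork, hv, false_and, and_false, or_false,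
    SimpleGraph.top_adj, Prod.mk.injEq]
  constructor
  · rintro ⟨rfl, h⟩
    exact ⟨w, ⟨rfl, rfl⟩, h⟩
  · rintro ⟨w, ⟨rfl, rfl⟩, h⟩
    exact ⟨rfl, h⟩

theorem joinedNetwork_label (b : Bool) (v w : Fin (n + 1)) :
    (joinedNetwork u).label (b, v) (b, w) = (completeNetwork n).label v w :=
  if_pos rfl

theorem joinedNetwork_labels {b : Bool} {v : Fin (n + 1)} (hv : v ≠ u b) :
    (joinedNetwork u).labels (b, v) = (completeNetwork n).labels v := by
  classical
  ext p
  simp only [Network.labels, Finset.mem_image, Finset.mem_filter, Finset.mem_univ, true_and]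
  constructor
  · rintro ⟨y, hy, rfl⟩
    obtain ⟨w, rfl, hw⟩ := (joinedNetwork_adj hv y).1 hy
    exact ⟨w, hw, (joinedNetwork_label b v w).symm⟩
  · rintro ⟨w, hw, rfl⟩
    exact ⟨(b, w), (joinedNetwork_adj hv _).2 ⟨w, rfl, hw⟩, joinedNetwork_label b v w⟩

theorem joinedNetwork_dest {b : Bool} {v : Fin (n + 1)} (hv : v ≠ u b) (p : ℕ) :
    (joinedNetwork u).dest (b, v) p = ((completeNetwork n).dest v p).map (Prod.mk b) := by
  ext y
  rw [Network.dest_eq_some_iff, joinedNetwork_adj hv]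
  simp only [Option.map_eq_some_iff, Network.dest_eq_some_iff]
  constructor
  · rintro ⟨⟨w, rfl, hw⟩, rfl⟩
    exact ⟨w, ⟨hw, (joinedNetwork_label b v w).symm⟩, rfl⟩
  · rintro ⟨w, ⟨hw, rfl⟩, rfl⟩
    exact ⟨⟨w, rfl, hw⟩, joinedNetwork_label b v w⟩

/-- The index of the `i`-th agent of the copy `b`, among the agents of two copies. -/
def agentCopy : Bool → Fin k → Fin (k + k)
  | false => Fin.castAdd k
  | true => Fin.natAdd k

theorem agentCopy_inj {b b' : Bool} {i i' : Fin k} :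
    agentCopy b i = agentCopy b' i' ↔ b = b' ∧ i = i' := by
  cases b <;> cases b' <;> simp [agentCopy, Fin.ext_iff] <;> omega

/-- `agentCopy b` as an embedding. -/
def agentEmbedding (b : Bool) : Fin k ↪ Fin (k + k) :=
  ⟨agentCopy b, fun _ _ h => (agentCopy_inj.1 h).2⟩

theorem agentEmbedding_apply (b : Bool) (i : Fin k) : agentEmbedding b i = agentCopy b i :=
  rfl

theorem exists_agentCopy (j : Fin (k + k)) : ∃ b i, agentCopy b i = j :=
  Fin.addCases (fun i => ⟨false, i, rfl⟩) (fun i => ⟨true, i, rfl⟩) j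

/-- The action order of `run` on the joined network is thus one copy after the other, which lets the
copies be simulated in turn. -/
theorem finRange_eq_agentCopy (k : ℕ) :
    List.finRange (k + k) = (List.finRange k).map (agentCopy false) ++
      (List.finRange k).map (agentCopy true) := by
  simp only [← List.ofFn_id, List.map_ofFn, List.ofFn_add]
  rfl

/-- The configuration `c'` of two copies of a network consists of the configurations `c false` and
`c true` of the copies. -/
structure Joined (c : Bool → Config A (Fin (n + 1)) k)
    (c' : Config A (Bool × Fin (n + 1)) (k + k)) : Prop where
  pos : ∀ b i, c'.pos (agentCopy b i) = (b, (c b).pos i)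
  mem : ∀ b i, c'.mem (agentCopy b i) = (c b).mem i
  moved : ∀ b i, c'.moved (agentCopy b i) = (c b).moved i
  inLabel : ∀ b i, c'.inLabel (agentCopy b i) = (c b).inLabel i
  board : ∀ b v, c'.board (b, v) = (c b).board v

theorem exists_joined (c : Bool → Config A (Fin (n + 1)) k) :
    ∃ c' : Config A (Bool × Fin (n + 1)) (k + k), Joined c c' := by
  refine ⟨⟨Fin.append (fun i => (false, (c false).pos i)) (fun i => (true, (c true).pos i)),
    Fin.append (c false).mem (c true).mem, Fin.append (c false).moved (c true).moved,
    Fin.append (c false).inLabel (c true).inLabel, fun v => (c v.1).board v.2⟩, ?_, ?_, ?_, ?_,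
    fun _ _ => rfl⟩
  all_goals
    rintro (_ | _) i
    · simp only [agentCopy, Fin.append_left]
    · simp only [agentCopy, Fin.append_right]

variable {x : Bool → I} {info : Fin (k + k) → I}

/-- The new link alters the labels only at the nodes `u b`, and agents of different copies are never
co-located; an agent away from `u b` perceives no difference. -/
theorem Joined.view {c : Bool → Config A (Fin (n + 1)) k}
    {c' : Config A (Bool × Fin (n + 1)) (k + k)} (h : Joined c c')
    (hx : ∀ b i, info (agentCopy b i) = x b) {b : Bool} {i : Fin k} (hu : (c b).pos i ≠ u b) :
    view M (joinedNetwork u) info c' (agentCopy b i) =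
      view M (completeNetwork n) (fun _ => x b) (c b) i := by
  classical
  have hothers : (Finset.univ.filter fun j => j ≠ agentCopy b i ∧
      c'.pos j = c'.pos (agentCopy b i)) =
      (Finset.univ.filter fun j => j ≠ i ∧ (c b).pos j = (c b).pos i).map
        (agentEmbedding b) := by
    ext j
    obtain ⟨b', i', rfl⟩ := exists_agentCopy j
    simp only [Finset.mem_filter, Finset.mem_univ, true_and, Finset.mem_map,
      agentEmbedding_apply, ne_eq, agentCopy_inj, h.pos, Prod.mk.injEq]
    constructor
    · rintro ⟨h₁, rfl, h₂⟩
      exact ⟨i', ⟨fun h₃ => h₁ ⟨rfl, h₃⟩, h₂⟩, rfl, rfl⟩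
    · rintro ⟨j, ⟨h₁, h₂⟩, rfl, rfl⟩
      exact ⟨fun h₃ => h₁ h₃.2, rfl, h₂⟩
  have hmem : c'.mem ∘ agentEmbedding b = (c b).mem := funext (h.mem b)
  simp only [MobileAgents.view, View.mk.injEq, hx, h.mem, h.moved, h.inLabel, true_and]
  refine ⟨?_, ?_, ?_⟩
  · rw [h.pos, joinedNetwork_labels hu]
  · have hmap := congrArg (fun S : Finset (Fin (k + k)) => S.val.map c'.mem) hothers
    simp only [Finset.map_val, Multiset.map_map, hmem] at hmap
    convert hmap
  · rw [h.pos, h.board]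

/-- The analogue of `Joined` in the course of an action phase. -/
structure JoinedState (s : Bool → Config A (Fin (n + 1)) k × (Fin k → Option (Fin (n + 1))))
    (s' : Config A (Bool × Fin (n + 1)) (k + k) ×
      (Fin (k + k) → Option (Bool × Fin (n + 1)))) : Prop where
  config : Joined (fun b => (s b).1) s'.1
  request : ∀ b i, s'.2 (agentCopy b i) = ((s b).2 i).map (Prod.mk b)

variable {s : Bool → Config A (Fin (n + 1)) k × (Fin k → Option (Fin (n + 1)))}
  {s' : Config A (Bool × Fin (n + 1)) (k + k) × (Fin (k + k) → Option (Bool × Fin (n + 1)))}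

theorem JoinedState.execute (h : JoinedState s s') (hx : ∀ b i, info (agentCopy b i) = x b)
    {b : Bool} {i : Fin k} (hu : (s b).1.pos i ≠ u b) :
    JoinedState
      (Function.update s b (execute M (completeNetwork n) (fun _ => x b) (s b) i))
      (execute M (joinedNetwork u) info s' (agentCopy b i)) := by
  classical
  have hview := h.config.view (M := M) hx hu
  have hpos := h.config.pos b i
  refine ⟨⟨fun b' i' => ?_, fun b' i' => ?_, fun b' i' => ?_, fun b' i' => ?_, fun b' v => ?_⟩,
    fun b' i' => ?_⟩ <;> by_cases hb : b' = b
  · subst hb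
    simpa [MobileAgents.execute] using h.config.pos b' i'
  · simpa [MobileAgents.execute, hb] using h.config.pos b' i'
  · subst hb
    by_cases hi : i' = i
    · subst hi
      simp [MobileAgents.execute, hview]
    · simpa [MobileAgents.execute, Function.update_apply, agentCopy_inj, hi]
        using h.config.mem b' i'
  · simpa [MobileAgents.execute, Function.update_apply, agentCopy_inj, hb]
      using h.config.mem b' i'
  · subst hb
    simpa [MobileAgents.execute] using h.config.moved b' i'
  · simpa [MobileAgents.execute, hb] using h.config.moved b' i'
  · subst hb
    simpa [MobileAgents.execute] using h.config.inLabel b' i'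
  · simpa [MobileAgents.execute, hb] using h.config.inLabel b' i'
  · subst hb
    by_cases hv : v = (s b').1.pos i
    · subst hv
      simp [MobileAgents.execute, hview, hpos]
    · simpa [MobileAgents.execute, Function.update_apply, hpos, hv]
        using h.config.board b' v
  · simpa [MobileAgents.execute, Function.update_apply, hpos, hb]
      using h.config.board b' v
  · subst hb
    by_cases hi : i' = i
    · subst hi
      simp only [MobileAgents.execute, hview, Function.update_self]
      rw [hpos]
      cases (A.act (MobileAgents.view M (completeNetwork n) (fun _ => x b') (s b').1 i')).move with
      | none => rfl
      | some p => exact joinedNetwork_dest hu p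
    · simpa [MobileAgents.execute, Function.update_apply, agentCopy_inj, hi]
        using h.request b' i'
  · simpa [MobileAgents.execute, Function.update_apply, agentCopy_inj, hb]
      using h.request b' i'

theorem JoinedState.foldl (h : JoinedState s s') (hx : ∀ b i, info (agentCopy b i) = x b)
    {b : Bool} (hu : ∀ i, (s b).1.pos i ≠ u b) (L : List (Fin k)) :
    JoinedState
      (Function.update s b
        (L.foldl (MobileAgents.execute M (completeNetwork n) (fun _ => x b)) (s b)))
      ((L.map (agentCopy b)).foldl (MobileAgents.execute M (joinedNetwork u) info) s') := by
  induction L generalizing s s' with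
  | nil => simpa using h
  | cons i L ih =>
    have h' := ih (h.execute (M := M) hx (hu i)) (fun j => by
      simpa [MobileAgents.execute] using hu j)
    simpa using h'

variable {c : Bool → Config A (Fin (n + 1)) k} {c' : Config A (Bool × Fin (n + 1)) (k + k)}

theorem Joined.actionPhase (h : Joined c c') (hx : ∀ b i, info (agentCopy b i) = x b)
    (hu : ∀ b i, (c b).pos i ≠ u b) :
    JoinedState (fun b => actionPhase M (completeNetwork n) (fun _ => x b) 1 (c b))
      (actionPhase M (joinedNetwork u) info 1 c') := by
  have h₀ : JoinedState (fun b => (c b, fun _ => none)) (c', fun _ => none) := ⟨h, fun _ _ => rfl⟩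
  have h₁ := h₀.foldl (M := M) hx (b := false) (hu false) (List.finRange k)
  have h₂ := h₁.foldl (M := M) hx (b := true) (by simpa using hu true) (List.finRange k)
  rw [← List.foldl_append, ← finRange_eq_agentCopy] at h₂
  unfold MobileAgents.actionPhase
  simp only [Equiv.Perm.coe_one, List.map_id]
  convert h₂ using 1
  funext b
  cases b <;> simp

/-- Two copies in which no agent moves can be run side by side. -/
theorem Joined.run (h : Joined c c') (hx : ∀ b i, info (agentCopy b i) = x b)
    (hu : ∀ b i, (c b).pos i ≠ u b)
    (hstill : ∀ b t, (run M (completeNetwork n) (fun _ => x b) (c b) t).pos = (c b).pos) (t : ℕ) :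
    Joined (fun b => run M (completeNetwork n) (fun _ => x b) (c b) t)
      (run M (joinedNetwork u) info c' t) := by
  induction t with
  | zero => exact h
  | succ t ih =>
    have ha := ih.actionPhase (M := M) hx (u := u) (fun b i => by rw [hstill]; exact hu b i)
    -- Stillness means that no link is even requested, so no half-duplex conflict has to be compared
    -- between the copies and the joined network.
    have hnone : ∀ b i, (MobileAgents.actionPhase M (completeNetwork n) (fun _ => x b) 1
        (MobileAgents.run M (completeNetwork n) (fun _ => x b) (c b) t)).2 i = none :=
      fun b i => request_eq_none (fun _ _ => wellOrderingRel_iff_not)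
        ((hstill b (t + 1)).trans (hstill b t).symm) i
    have hnone' : ∀ j, (MobileAgents.actionPhase M (joinedNetwork u) info 1
        (MobileAgents.run M (joinedNetwork u) info c' t)).2 j = none := by
      intro j
      obtain ⟨b, i, rfl⟩ := exists_agentCopy j
      rw [ha.request, hnone, Option.map_none]
    simp only [MobileAgents.run]
    rw [migrationPhase_eq_of_request_eq_none hnone']
    simp only [migrationPhase_eq_of_request_eq_none (hnone _)]
    exact ⟨ha.config.pos, ha.config.mem, fun _ _ => rfl, ha.config.inLabel, ha.config.board⟩

end Joined

/-! ### Not all agents can become quiescent. -/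

section Impossibility

variable {I V : Type} {k : ℕ} [Fintype V] {A : Algorithm I} {M : Variant} {N : Network V}
  {info : Fin k → I}

theorem run_add (c : Config A V k) (T t : ℕ) :
    run M N info (run M N info c T) t = run M N info c (T + t) := by
  induction t with
  | zero => rfl
  | succ t ih => rw [run, ih, ← Nat.add_assoc, run]

/-- If all `k` agents become quiescent, there is a quiescent configuration of `k` agents with gossip
information `x` on a complete network with an empty node, in which only `x` is known. -/
theorem IsQuiescent.exists_still {l : ℕ} (hq : IsQuiescent M A k l) (hl : k ≤ l) (x : I) :
    ∃ (c : Config A (Fin (k + 1)) k) (u : Fin (k + 1)), OnlyKnows x c ∧ (∀ i, c.pos i ≠ u) ∧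
      ∀ t, (run M (completeNetwork k) (fun _ => x) c t).pos = c.pos := by
  obtain ⟨c₀, h₀⟩ := exists_onlyKnows (k := k) A x (0 : Fin (k + 1))
  obtain ⟨T, S, hS, hstill⟩ := hq (Fin (k + 1)) (completeNetwork k) (fun _ => x) _
    (isExecution_run c₀)
  have hS' : S = Finset.univ :=
    Finset.eq_univ_of_card S (le_antisymm (Finset.card_le_univ S) (by simpa using hl.trans hS))
  subst hS'
  set c := run M (completeNetwork k) (fun _ => x) c₀ T
  -- An empty node exists because `k` agents cannot occupy `k + 1` nodes.
  obtain ⟨u, hu⟩ : ∃ u, u ∉ Set.range c.pos := by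
    by_contra! hsurj
    simpa using Fintype.card_le_of_surjective c.pos hsurj
  refine ⟨c, u, h₀.run (fun _ => rfl) T, fun i hi => hu ⟨i, hi⟩, fun t => ?_⟩
  rw [run_add]
  exact funext fun i => hstill i (Finset.mem_univ i) _ (Nat.le_add_right _ _)

/-- Otherwise still configurations for two different pieces, joined at empty nodes, give an
execution of `2k` agents in which the first copy never learns the piece of the second. -/
theorem SolvesGossip.lt_of_isQuiescent [Nontrivial I] (hA : SolvesGossip M A) (hk : 1 ≤ k) {l : ℕ}
    (hq : IsQuiescent M A k l) : l < k := by
  by_contra! hl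
  obtain ⟨y, z, hyz⟩ := exists_pair_ne I
  let x : Bool → I := fun b => if b then z else y
  choose c u honly hu hstill using fun b => hq.exists_still hl (x b)
  obtain ⟨c', hc'⟩ := exists_joined c
  let info : Fin (k + k) → I := Fin.append (fun _ => y) (fun _ => z)
  have hinfo : ∀ b i, info (agentCopy b i) = x b := by
    rintro (_ | _) i
    · exact Fin.append_left _ _ i
    · exact Fin.append_right _ _ i
  obtain ⟨T, hT⟩ := hA _ (joinedNetwork u) (k + k) info _ (isExecution_run c')
  have hknown := hT T le_rfl (agentCopy false ⟨0, hk⟩) (agentCopy true ⟨0, hk⟩)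
  rw [(hc'.run hinfo hu hstill T).mem, hinfo] at hknown
  exact hyz (((honly false).run (fun _ => rfl) T).mem _ _ hknown).symm

end Impossibility

end MobileAgents

theorem mainTheorem10 (I : Type) [Nontrivial I] (M : MobileAgents.Variant) (k : ℕ) (hk : 1 ≤ k) :
    ∃ q : ℤ, MobileAgents.IsQuiescenceNumber I M k q ∧ 0 ≤ q ∧ q ≤ (k : ℤ) - 1 := by
  classical
  let P : ℕ → Prop := fun l => ∃ A : MobileAgents.Algorithm I,
    MobileAgents.SolvesGossip M A ∧ MobileAgents.IsQuiescent M A k l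
  have h₀ : P 0 := ⟨MobileAgents.rotor I, MobileAgents.solvesGossip_rotor I M,
    MobileAgents.isQuiescent_zero M _ k⟩
  have hlt : ∀ l, P l → l < k := fun l ⟨_, hA, hq⟩ => hA.lt_of_isQuiescent hk hq
  -- Searching up to `k` loses nothing, since `P l` forces `l < k`.
  have hmax : P (Nat.findGreatest P k) := Nat.findGreatest_spec (Nat.zero_le k) h₀
  have hmaxlt := hlt _ hmax
  refine ⟨(Nat.findGreatest P k : ℕ), ⟨Or.inr ⟨_, rfl, hmax⟩, ?_⟩, by omega, by omega⟩
  rintro _ (rfl | ⟨l, rfl, hl⟩)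
  · omega
  · exact_mod_cast Nat.le_findGreatest (hlt l hl).le hl
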